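/- Storage reallocation. Objects have names and positive integer lengths and are stored in disjoint intervals of cells of an infinite array with cells $0,1,2,\dots$. An execution is a finite sequence of requests, each of which either inserts a new object (a name that is not currently active, with a length $w\ge 1$) or deletes an active object. A cost-oblivious reallocator $A$ outputs, after each request, start addresses for all active objects (those inserted and not yet deleted) such that distinct active objects occupy disjoint intervals; this output depends only on the requests served so far, and in particular not on any cost function. The footprint of an allocation is the least $L$ such that all active objects lie in the cells $0,\dots,L-1$, and the volume $V_t$ is the total length of the objects active after $t$ requests. For a cost function $f$, the reallocation cost of a request is the sum of $f(w)$ over the lengths $w$ of all objects that are active both before and after the request and whose start addresses before and after it differ. $A$ is $(f,a,b)$-competitive if, for every execution, after every request, (1) the footprint is at most $a$ times the minimum footprint of any allocation of the active objects, and (2) the total reallocation cost so far is at most $b$ times the sum of $f(w)$ over the lengths $w$ of all objects inserted so far (including those deleted since). Theorem. There is an absolute constant $C>0$ such that for every $0<\varepsilon\le 1/2$ there is a cost-oblivious reallocator $A$ that is $\bigl(f,\,1+\varepsilon,\,C\,\tfrac1\varepsilon\log\tfrac1\varepsilon\bigr)$-competitive for every monotonically (weakly) increasing subadditive cost function $f$,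 i.e. every real-valued $f$ on the positive integers with $f(x)\le f(y)$ for $x\le y$ and $f(x+y)\le f(x)+f(y)$. Moreover, in every execution, after every request $t$, the footprint of $A$ is at most $(1+\varepsilon)V_t$. -/

import Mathlib

namespace StorageRealloc

universe u

/-- A request: insert an object with a given name and (integral) length, or delete the object
with a given name. -/
inductive Request (α : Type u) : Type u
  | insert (name : α) (length : ℕ)
  | delete (name : α)

variable {α : Type u}

/-- The lengths of the active objects after serving the requests in `h`, most recent request
first. A name is active iff its value is nonzero (lengths of objects are positive), so the support
is the set of active objects. -/
noncomputable def active : List (Request α) → α →₀ ℕ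
  | [] => 0
  | Request.insert n w :: h => (active h).update n w
  | Request.delete n :: h => (active h).erase n

/-- `IsExecution h`: the list `h` (most recent request first) is a legal sequence of requests. An
inserted object has positive length and its name is not in use; only active objects are deleted.
The name of a deleted object may be used again for a new object. -/
def IsExecution : List (Request α) → Prop
  | [] => True
  | Request.insert n w :: h => IsExecution h ∧ n ∉ (active h).support ∧ 0 < w
  | Request.delete n :: h => IsExecution h ∧ n ∈ (active h).support

/-- The volume: the total length of the objects in `s`. -/
def volume (s : α →₀ ℕ) : ℕ := ∑ n ∈ s.support, s n

/-- `x` gives every object of `s` a start address in the array of cells `0, 1, 2, …`, so that the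
object `n` occupies the cells `x n, …, x n + s n - 1`; distinct objects occupy disjoint sets of
cells. The values of `x` at names outside `s` are irrelevant. -/
def IsAllocation (s : α →₀ ℕ) (x : α → ℕ) : Prop :=
  (s.support : Set α).PairwiseDisjoint fun n => Set.Ico (x n) (x n + s n)

/-- The footprint: the length of the shortest prefix of the array that contains all objects. -/
def footprint (s : α →₀ ℕ) (x : α → ℕ) : ℕ := s.support.sup fun n => x n + s n

/-- A (deterministic, online) reallocator: after each request it outputs an allocation of the
active objects, which depends on the requests served so far and on nothing else. In particular no
cost function enters, so every reallocator in this sense is cost oblivious. -/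
structure Reallocator (α : Type u) where
  /-- the start addresses after the requests of the given history, most recent request first -/
  place : List (Request α) → α → ℕ
  isAllocation : ∀ h, IsExecution h → IsAllocation (active h) (place h)

/-- The cost, for the cost function `f`, of passing from the allocation `x` of the objects `s` to
the allocation `x'` of the objects `s'`: the sum of `f (length)` over all objects that are present
in both and have been moved. -/
def moveCost (f : ℕ → ℝ) (s s' : α →₀ ℕ) (x x' : α → ℕ) : ℝ :=
  ∑ n ∈ s.support with s' n ≠ 0 ∧ x n ≠ x' n, f (s n)

/-- The total reallocation cost of all requests in the history. -/
noncomputable def reallocCost (f : ℕ → ℝ) (A : Reallocator α) : List (Request α) → ℝ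
  | [] => 0
  | r :: h => reallocCost f A h +
      moveCost f (active h) (active (r :: h)) (A.place h) (A.place (r :: h))

/-- The sum of the allocation costs of all objects ever inserted, including those that have been
deleted since. -/
noncomputable def allocCost (f : ℕ → ℝ) : List (Request α) → ℝ
  | [] => 0
  | Request.insert _ w :: h => allocCost f h + f w
  | Request.delete _ :: h => allocCost f h

/-- Cost functions (of the positive integral length of an object) that are monotonically
increasing and subadditive. Such a function is automatically nonnegative at positive lengths. -/
structure IsSubadditiveCost (f : ℕ → ℝ) : Prop where
  mono : ∀ x y, 0 < x → x ≤ y → f x ≤ f y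
  subadd : ∀ x y, 0 < x → 0 < y → f (x + y) ≤ f x + f y

/-- `A` is `(f, a, b)`-competitive: at all times the footprint is at most `a` times the footprint
of any allocation of the active objects, hence of an optimal one, and the reallocation cost so far
is at most `b` times the sum of the allocation costs of all objects inserted so far. -/
def Reallocator.IsCompetitive (A : Reallocator α) (f : ℕ → ℝ) (a b : ℝ) : Prop :=
  ∀ h, IsExecution h →
    (∀ y, IsAllocation (active h) y →
      (footprint (active h) (A.place h) : ℝ) ≤ a * footprint (active h) y) ∧
    reallocCost f A h ≤ b * allocCost f h

end StorageRealloc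

/-! The objects of length in `[2 ^ j, 2 ^ (j + 1))` form the size class `j`. The array is divided
into one region per size class, consisting of a payload segment and of a buffer of `1 / N` of its
size, where `N ≈ 4 / ε`. A request for an object of class `i`, be it an insertion or a deletion, is
recorded in the first buffer `j ≥ i` that has room for the length of the object. When no buffer
has room, all regions from some `b ≤ i` on are rebuilt with empty buffers, where `b` is the largest
index such that no request of a class below `b` is recorded in a buffer from `b` on.

Let `P` be the payload of a rebuilt region `j`. By the choice of `b`, some request of class at most
`j` did not fit into buffer `j`, so that the requests in this buffer or that request alone have
total length at least `P / (2 * N)`. Subadditivity makes the cost per cell nonincreasing in the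
length up to a factor of `2`, so these requests can pay for moving class `j` at `O(N)` times their
own cost. A request pays in this way for the buffer which it is in, and, since `2 ^ j ≤ P`, for
`O(log N)` classes `j` into whose buffer it did not fit.

A payload segment differs from the volume of its class only by recorded requests, whose total
length is at most `1 / N` of all payload. Hence the footprint is at most
`(1 + 1 / N) / (1 - 1 / N)` times the volume. -/

namespace StorageRealloc

universe u

/-! ### Cost functions -/

section CostFunctions

variable {f : ℕ → ℝ} {x y : ℕ}

theorem IsSubadditiveCost.nonneg (hf : IsSubadditiveCost f) (hx : 0 < x) : 0 ≤ f x := by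
  have hmono := hf.mono x (x + x) hx (by omega)
  have hsub := hf.subadd x x hx hx
  linarith

theorem IsSubadditiveCost.apply_succ_mul_le (hf : IsSubadditiveCost f) (hx : 0 < x) (k : ℕ) :
    f ((k + 1) * x) ≤ (k + 1 : ℕ) * f x := by
  induction k with
  | zero => simp
  | succ k ih =>
    have hsub := hf.subadd ((k + 1) * x) x (by positivity) hx
    rw [add_one_mul (k + 1) x]
    push_cast at ih ⊢
    linarith

theorem IsSubadditiveCost.mul_apply_le (hf : IsSubadditiveCost f) (hx : 0 < x)
    (hxy : x < 2 * y) : x * f y ≤ 2 * y * f x := by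
  have hle : y ≤ (y / x + 1) * x := by
    rw [mul_comm]
    exact (Nat.lt_mul_div_succ y hx).le
  have hle' : x * (y / x + 1) ≤ 2 * y := by
    rcases le_or_gt x y with h | h
    · have := Nat.mul_div_le y x
      rw [mul_add]
      omega
    · simpa [Nat.div_eq_of_lt h] using hxy.le
  have hfx := hf.nonneg hx
  calc (x : ℝ) * f y ≤ x * ((y / x + 1 : ℕ) * f x) := by
        gcongr
        exact (hf.mono _ _ (by omega) hle).trans (hf.apply_succ_mul_le hx _)
    _ = (x * (y / x + 1) : ℕ) * f x := by push_cast; ring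
    _ ≤ (2 * y : ℕ) * f x := by gcongr
    _ = 2 * y * f x := by push_cast; rfl

end CostFunctions

/-! ### Size classes -/

/-- The size class of an object of length `w`, which is `j` for `2 ^ j ≤ w < 2 ^ (j + 1)`. -/
def sizeClass (w : ℕ) : ℕ := Nat.log 2 w

theorem two_pow_sizeClass_le {w : ℕ} (hw : w ≠ 0) : 2 ^ sizeClass w ≤ w :=
  Nat.pow_log_le_self 2 hw

theorem lt_two_pow_sizeClass_add_one (w : ℕ) : w < 2 ^ (sizeClass w + 1) :=
  Nat.lt_pow_succ_log_self one_lt_two w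

theorem lt_two_mul_of_sizeClass_le {x y : ℕ} (hy : y ≠ 0) (hxy : sizeClass x ≤ sizeClass y) :
    x < 2 * y :=
  calc x < 2 ^ (sizeClass x + 1) := lt_two_pow_sizeClass_add_one x
    _ ≤ 2 ^ (sizeClass y + 1) := Nat.pow_le_pow_right two_pos (by omega)
    _ = 2 * 2 ^ sizeClass y := pow_succ' 2 _
    _ ≤ 2 * y := Nat.mul_le_mul_left 2 (two_pow_sizeClass_le hy)

theorem lt_sizeClass_add_of_two_pow_lt {j N x : ℕ} (h : 2 ^ j < 2 * N * x) :
    j < sizeClass x + (sizeClass N + 3) := by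
  rw [← Nat.pow_lt_pow_iff_right one_lt_two]
  calc 2 ^ j < 2 * N * x := h
    _ ≤ 2 * 2 ^ (sizeClass N + 1) * 2 ^ (sizeClass x + 1) := by
        gcongr <;> exact (lt_two_pow_sizeClass_add_one _).le
    _ = 2 ^ (sizeClass x + (sizeClass N + 3)) := by ring

variable {α : Type u}

/-- The objects of `s` in the size class `j`. -/
def classOf (s : α →₀ ℕ) (j : ℕ) : Finset α := {m ∈ s.support | sizeClass (s m) = j}

/-- The total length of the objects of `s` in the size class `j`. -/
def classVol (s : α →₀ ℕ) (j : ℕ) : ℕ := ∑ m ∈ classOf s j, s m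

/-- The cost of moving all objects of `s` in the size class `j`. -/
def classCost (f : ℕ → ℝ) (s : α →₀ ℕ) (j : ℕ) : ℝ := ∑ m ∈ classOf s j, f (s m)

/-- The cost per cell of moving all objects of `s` in the size class `j`; it is `0` if there are
none. -/
noncomputable def classPrice (f : ℕ → ℝ) (s : α →₀ ℕ) (j : ℕ) : ℝ := classCost f s j / classVol s j

theorem mem_classOf {s : α →₀ ℕ} {j : ℕ} {m : α} :
    m ∈ classOf s j ↔ s m ≠ 0 ∧ sizeClass (s m) = j := by
  simp [classOf]

theorem classVol_eq_zero_or_two_pow_le (s : α →₀ ℕ) (j : ℕ) :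
    classVol s j = 0 ∨ 2 ^ j ≤ classVol s j := by
  rcases (classOf s j).eq_empty_or_nonempty with hempty | ⟨m, hm⟩
  · exact .inl (by rw [classVol, hempty, Finset.sum_empty])
  · obtain ⟨hm0, rfl⟩ := mem_classOf.1 hm
    exact .inr ((two_pow_sizeClass_le hm0).trans
      (Finset.single_le_sum (f := s) (fun _ _ => Nat.zero_le _) hm))

theorem sum_range_classVol {s : α →₀ ℕ} {M : ℕ} (hM : ∀ m, s m ≠ 0 → sizeClass (s m) < M) :
    ∑ j ∈ Finset.range M, classVol s j = volume s :=
  Finset.sum_fiberwise_of_maps_to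
    (fun m hm => Finset.mem_range.2 (hM m (Finsupp.mem_support_iff.1 hm))) _

theorem sum_Ico_classCost (f : ℕ → ℝ) {s : α →₀ ℕ} (b : ℕ) {M : ℕ}
    (hM : ∀ m, s m ≠ 0 → sizeClass (s m) < M) :
    ∑ j ∈ Finset.Ico b M, classCost f s j = ∑ m ∈ s.support with b ≤ sizeClass (s m), f (s m) := by
  rw [← Finset.sum_fiberwise_of_maps_to (t := Finset.Ico b M) (g := fun m => sizeClass (s m))]
  · refine Finset.sum_congr rfl fun j hj => Finset.sum_congr ?_ fun _ _ => rfl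
    have hbj := (Finset.mem_Ico.1 hj).1
    ext m
    simp only [mem_classOf, Finset.mem_filter, Finsupp.mem_support_iff]
    grind
  · intro m hm
    simp only [Finset.mem_filter, Finsupp.mem_support_iff] at hm
    exact Finset.mem_Ico.2 ⟨hm.2, hM m hm.1⟩

section ClassPrice

variable {f : ℕ → ℝ} (hf : IsSubadditiveCost f) (s : α →₀ ℕ) (j : ℕ)

include hf

theorem classCost_nonneg : 0 ≤ classCost f s j :=
  Finset.sum_nonneg fun _ hm => hf.nonneg (Nat.pos_of_ne_zero (mem_classOf.1 hm).1)

theorem classPrice_nonneg : 0 ≤ classPrice f s j :=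
  div_nonneg (classCost_nonneg hf s j) (Nat.cast_nonneg _)

theorem mul_classCost_le {x : ℕ} (hx : 0 < x) (hxj : sizeClass x ≤ j) :
    x * classCost f s j ≤ 2 * classVol s j * f x := by
  rw [classCost, classVol, Nat.cast_sum, Finset.mul_sum, Finset.mul_sum, Finset.sum_mul]
  refine Finset.sum_le_sum fun m hm => ?_
  obtain ⟨hm0, rfl⟩ := mem_classOf.1 hm
  exact hf.mul_apply_le hx (lt_two_mul_of_sizeClass_le hm0 hxj)

theorem mul_classPrice_le {x : ℕ} (hx : 0 < x) (hxj : sizeClass x ≤ j) :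
    x * classPrice f s j ≤ 2 * f x := by
  rw [classPrice, mul_div_assoc']
  refine div_le_of_le_mul₀ (Nat.cast_nonneg _) (mul_nonneg zero_le_two (hf.nonneg hx)) ?_
  linarith [mul_classCost_le hf s j hx hxj]

omit hf in
theorem classVol_mul_classPrice : classVol s j * classPrice f s j = classCost f s j := by
  rcases Nat.eq_zero_or_pos (classVol s j) with hvol | hvol
  · have hempty : classOf s j = ∅ := Finset.eq_empty_of_forall_notMem fun m hm =>
      (mem_classOf.1 hm).1 (Finset.sum_eq_zero_iff.1 hvol m hm)
    rw [hvol, Nat.cast_zero, zero_mul, classCost, hempty, Finset.sum_empty]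
  · exact mul_div_cancel₀ _ (by positivity)

end ClassPrice

/-! ### Entries of the buffers -/

theorem sum_sum_map_filter {ι β M : Type*} [AddCommMonoid M] (I : Finset ι) (E : Multiset β)
    (R : β → ι → Prop) [∀ p j, Decidable (R p j)] (g : β → M) :
    ∑ j ∈ I, ((E.filter (R · j)).map g).sum =
      (E.map fun p => (I.filter (R p)).card • g p).sum := by
  induction E using Multiset.induction_on with
  | empty => simp
  | cons p E ih =>
    simp only [Multiset.filter_cons, Multiset.map_add, Multiset.sum_add, Finset.sum_add_distrib,
      Multiset.map_cons, Multiset.sum_cons, ih]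
    congr 1
    rw [← Finset.sum_const, Finset.sum_filter]
    refine Finset.sum_congr rfl fun j _ => ?_
    split_ifs <;> simp

/-- A request recorded in a buffer: the length of the inserted or deleted object and the index of
the buffer. -/
structure Entry where
  length : ℕ
  buffer : ℕ

/-- An entry is admissible if it is for a nonempty object and in the buffer of its size class or of
a larger one. -/
def Entry.IsAdmissible (p : Entry) : Prop := 0 < p.length ∧ sizeClass p.length ≤ p.buffer

/-- The entry was not recorded in buffer `j`, although it would have been admissible there and `j`
comes before the buffer that it is in. -/
def Entry.Skips (p : Entry) (j : ℕ) : Prop := sizeClass p.length ≤ j ∧ j < p.buffer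

/-- The total length of the entries. -/
def totalLength (E : Multiset Entry) : ℕ := (E.map Entry.length).sum

/-- The total cost of the requests recorded by the entries. -/
noncomputable def entryCost (f : ℕ → ℝ) (E : Multiset Entry) : ℝ :=
  (E.map fun p => f p.length).sum

/-- The number of cells of buffer `j` that are taken up by entries. -/
def fill (E : Multiset Entry) (j : ℕ) : ℕ := totalLength (E.filter (·.buffer = j))

/-- The total length of the entries for objects of size class `j`, in whichever buffer they are. -/
def pending (E : Multiset Entry) (j : ℕ) : ℕ := totalLength (E.filter (sizeClass ·.length = j))

theorem fill_cons (p : Entry) (E : Multiset Entry) (j : ℕ) :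
    fill (p ::ₘ E) j = (if p.buffer = j then p.length else 0) + fill E j := by
  unfold fill totalLength
  rw [Multiset.filter_cons, Multiset.map_add, Multiset.sum_add]
  split_ifs <;> simp

theorem pending_cons (p : Entry) (E : Multiset Entry) (j : ℕ) :
    pending (p ::ₘ E) j = (if sizeClass p.length = j then p.length else 0) + pending E j := by
  unfold pending totalLength
  rw [Multiset.filter_cons, Multiset.map_add, Multiset.sum_add]
  split_ifs <;> simp

theorem entryCost_cons (f : ℕ → ℝ) (p : Entry) (E : Multiset Entry) :
    entryCost f (p ::ₘ E) = f p.length + entryCost f E := by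
  rw [entryCost, Multiset.map_cons, Multiset.sum_cons, entryCost]

theorem fill_filter {E : Multiset Entry} {Q : Entry → Prop} [DecidablePred Q] {j : ℕ}
    (h : ∀ p ∈ E, p.buffer = j → Q p) : fill (E.filter Q) j = fill E j := by
  rw [fill, Multiset.filter_filter, Multiset.filter_congr fun p hp => and_iff_left_of_imp (h p hp),
    fill]

theorem fill_eq_zero {E : Multiset Entry} {j : ℕ} (h : ∀ p ∈ E, p.buffer ≠ j) : fill E j = 0 := by
  rw [fill, Multiset.filter_eq_nil.2 h]
  rfl

theorem pending_filter {E : Multiset Entry} {Q : Entry → Prop} [DecidablePred Q] {j : ℕ}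
    (h : ∀ p ∈ E, sizeClass p.length = j → Q p) : pending (E.filter Q) j = pending E j := by
  rw [pending, Multiset.filter_filter,
    Multiset.filter_congr fun p hp => and_iff_left_of_imp (h p hp), pending]

theorem sum_range_totalLength_filter {E : Multiset Entry} {g : Entry → ℕ} {M : ℕ}
    (hM : ∀ p ∈ E, g p < M) :
    ∑ j ∈ Finset.range M, totalLength (E.filter (g · = j)) = totalLength E := by
  unfold totalLength
  rw [sum_sum_map_filter]
  refine congrArg _ (Multiset.map_congr rfl fun p hp => ?_)
  rw [Finset.filter_eq, if_pos (Finset.mem_range.2 (hM p hp)), Finset.card_singleton, one_nsmul]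

section EntryCost

variable {f : ℕ → ℝ} {E : Multiset Entry}

theorem entryCost_nonneg (h : ∀ p ∈ E, 0 ≤ f p.length) : 0 ≤ entryCost f E :=
  Multiset.sum_nonneg fun c hc => by
    obtain ⟨p, hp, rfl⟩ := Multiset.mem_map.1 hc
    exact h p hp

theorem le_entryCost (h : ∀ p ∈ E, 0 ≤ f p.length) {p : Entry} (hp : p ∈ E) :
    f p.length ≤ entryCost f E := by
  refine Multiset.single_le_sum (fun c hc => ?_) _ (Multiset.mem_map_of_mem _ hp)
  obtain ⟨q, hq, rfl⟩ := Multiset.mem_map.1 hc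
  exact h q hq

theorem entryCost_filter_add_entryCost_filter_not (f : ℕ → ℝ) (E : Multiset Entry)
    (Q : Entry → Prop) [DecidablePred Q] :
    entryCost f (E.filter Q) + entryCost f (E.filter fun p => ¬ Q p) = entryCost f E := by
  unfold entryCost
  rw [← Multiset.sum_add, ← Multiset.map_add, Multiset.filter_add_not]

theorem totalLength_mul_le {q c : ℝ} (h : ∀ p ∈ E, p.length * q ≤ c * f p.length) :
    totalLength E * q ≤ c * entryCost f E := by
  rw [totalLength, entryCost, Nat.cast_multiset_sum, Multiset.map_map, ← Multiset.sum_map_mul_right,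
    ← Multiset.sum_map_mul_left]
  exact Multiset.sum_map_le_sum_map _ _ h

theorem sum_entryCost_filter_le (I : Finset ℕ) (R : Entry → ℕ → Prop)
    [∀ p j, Decidable (R p j)] {k : ℕ} (hf : ∀ p ∈ E, 0 ≤ f p.length)
    (hk : ∀ p ∈ E, (I.filter (R p)).card ≤ k) :
    ∑ j ∈ I, entryCost f (E.filter (R · j)) ≤ k * entryCost f E := by
  unfold entryCost
  rw [sum_sum_map_filter, ← Multiset.sum_map_mul_left]
  refine Multiset.sum_map_le_sum_map _ _ fun p hp => ?_
  rw [nsmul_eq_mul]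
  have := hf p hp
  gcongr
  exact hk p hp

end EntryCost

/-! ### Charging the cost of a flush to the entries -/

/-- The number of size classes that an entry may have to pay for because it does not fit into their
buffers. -/
def spread (N : ℕ) : ℕ := sizeClass N + 3

/-- The amortization factor: a flush costs at most `rate N` times the total cost of the request that
causes it and of the requests that it removes from the buffers. -/
noncomputable def rate (N : ℕ) : ℝ := 2 + 4 * N + 4 * N * spread N

theorem rate_nonneg (N : ℕ) : 0 ≤ rate N := by
  unfold rate
  positivity

/-- The entries of size class at most `j` that pay for moving size class `j` if they do not fit
into buffer `j`. -/
def nearEntries (N : ℕ) (E : Multiset Entry) (j : ℕ) : Multiset Entry :=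
  E.filter fun p => sizeClass p.length ≤ j ∧ j < sizeClass p.length + spread N

section Charging

variable {f : ℕ → ℝ} (hf : IsSubadditiveCost f) (s : α →₀ ℕ) {E : Multiset Entry}
  (hE : ∀ p ∈ E, p.IsAdmissible)

include hf hE

theorem pending_mul_classPrice_le (j : ℕ) :
    pending E j * classPrice f s j ≤ 2 * entryCost f (E.filter (sizeClass ·.length = j)) :=
  totalLength_mul_le fun p hp => by
    obtain ⟨hp, hpj⟩ := Multiset.mem_filter.1 hp
    exact mul_classPrice_le hf s j (hE p hp).1 hpj.le

theorem fill_mul_classPrice_le (j : ℕ) :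
    fill E j * classPrice f s j ≤ 2 * entryCost f (E.filter (·.buffer = j)) :=
  totalLength_mul_le fun p hp => by
    obtain ⟨hp, hpj⟩ := Multiset.mem_filter.1 hp
    exact mul_classPrice_le hf s j (hE p hp).1 ((hE p hp).2.trans hpj.le)

theorem payload_mul_classPrice_le {N P j : ℕ} (hP : P = 0 ∨ 2 ^ j ≤ P)
    (hover : ∃ p ∈ E, sizeClass p.length ≤ j ∧ P < N * (fill E j + p.length)) :
    P * classPrice f s j ≤ 4 * N * entryCost f (E.filter (·.buffer = j)) +
      4 * N * entryCost f (nearEntries N E j) := by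
  obtain ⟨p, hp, hpj, hlt⟩ := hover
  have hprice := classPrice_nonneg hf s j
  have hnonneg : ∀ {Q : Entry → Prop} [DecidablePred Q], ∀ p ∈ E.filter Q, 0 ≤ f p.length :=
    fun p hp => hf.nonneg (hE p (Multiset.mem_filter.1 hp).1).1
  have hbuffer := entryCost_nonneg (hnonneg (Q := (·.buffer = j)))
  have hnear : 0 ≤ entryCost f (nearEntries N E j) := entryCost_nonneg hnonneg
  have hcharge : ∀ {x : ℕ} {c : ℝ}, P ≤ 2 * N * x → x * classPrice f s j ≤ 2 * c →
      P * classPrice f s j ≤ 4 * N * c := fun {x c} hPx hx =>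
    calc (P : ℝ) * classPrice f s j ≤ (2 * N * x : ℕ) * classPrice f s j := by gcongr
      _ = 2 * N * (x * classPrice f s j) := by push_cast; ring
      _ ≤ 2 * N * (2 * c) := mul_le_mul_of_nonneg_left hx (by positivity)
      _ = 4 * N * c := by ring
  rcases le_total p.length (fill E j) with hle | hle
  · exact (hcharge (by nlinarith) (fill_mul_classPrice_le hf s hE j)).trans
      (le_add_of_nonneg_right (by positivity))
  · have hlt' : P < 2 * N * p.length := by nlinarith
    rcases hP with rfl | hP
    · simp only [Nat.cast_zero, zero_mul]
      positivity
    have hmem : p ∈ nearEntries N E j :=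
      Multiset.mem_filter.2 ⟨hp, hpj, lt_sizeClass_add_of_two_pow_lt (hP.trans_lt hlt')⟩
    have hcost := mul_le_mul_of_nonneg_left (le_entryCost hnonneg hmem) zero_le_two
    exact (hcharge hlt'.le ((mul_classPrice_le hf s j (hE p hp).1 hpj).trans hcost)).trans
      (le_add_of_nonneg_left (by positivity))

theorem classCost_le {N P j : ℕ} (hP : P = 0 ∨ 2 ^ j ≤ P)
    (hvol : classVol s j ≤ P + pending E j)
    (hover : ∃ p ∈ E, sizeClass p.length ≤ j ∧ P < N * (fill E j + p.length)) :
    classCost f s j ≤ 2 * entryCost f (E.filter (sizeClass ·.length = j)) +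
      (4 * N * entryCost f (E.filter (·.buffer = j)) +
        4 * N * entryCost f (nearEntries N E j)) := by
  have hprice := classPrice_nonneg hf s j
  calc classCost f s j = classVol s j * classPrice f s j := (classVol_mul_classPrice s j).symm
    _ ≤ (P + pending E j : ℕ) * classPrice f s j := by gcongr
    _ = pending E j * classPrice f s j + P * classPrice f s j := by push_cast; ring
    _ ≤ _ := add_le_add (pending_mul_classPrice_le hf s hE j)
      (payload_mul_classPrice_le hf s hE hP hover)

theorem sum_classCost_le (I : Finset ℕ) {N : ℕ} {P : ℕ → ℕ}
    (hP : ∀ j ∈ I, P j = 0 ∨ 2 ^ j ≤ P j) (hvol : ∀ j ∈ I, classVol s j ≤ P j + pending E j)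
    (hover : ∀ j ∈ I, ∃ p ∈ E, sizeClass p.length ≤ j ∧ P j < N * (fill E j + p.length)) :
    ∑ j ∈ I, classCost f s j ≤ rate N * entryCost f E := by
  have hcost : ∀ p ∈ E, 0 ≤ f p.length := fun p hp => hf.nonneg (hE p hp).1
  have hclass := sum_entryCost_filter_le I (fun p j => sizeClass p.length = j) (k := 1) hcost
    fun p _ => by rw [Finset.filter_eq]; split_ifs <;> simp
  have hbuffer := sum_entryCost_filter_le I (fun p j => p.buffer = j) (k := 1) hcost
    fun p _ => by rw [Finset.filter_eq]; split_ifs <;> simp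
  have hnear : ∑ j ∈ I, entryCost f (nearEntries N E j) ≤ spread N * entryCost f E :=
    sum_entryCost_filter_le I _ hcost fun p _ =>
      (Finset.card_le_card (t := Finset.Ico (sizeClass p.length) (sizeClass p.length + spread N))
        fun j hj => Finset.mem_Ico.2 (Finset.mem_filter.1 hj).2).trans (by simp)
  calc ∑ j ∈ I, classCost f s j
      ≤ ∑ j ∈ I, (2 * entryCost f (E.filter (sizeClass ·.length = j)) +
          (4 * N * entryCost f (E.filter (·.buffer = j)) +
            4 * N * entryCost f (nearEntries N E j))) :=
        Finset.sum_le_sum fun j hj => classCost_le hf s hE (hP j hj) (hvol j hj) (hover j hj)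
    _ = 2 * ∑ j ∈ I, entryCost f (E.filter (sizeClass ·.length = j)) +
          (4 * N * ∑ j ∈ I, entryCost f (E.filter (·.buffer = j)) +
            4 * N * ∑ j ∈ I, entryCost f (nearEntries N E j)) := by
        simp only [Finset.sum_add_distrib, Finset.mul_sum]
    _ ≤ 2 * ((1 : ℕ) * entryCost f E) + (4 * N * ((1 : ℕ) * entryCost f E) +
          4 * N * (spread N * entryCost f E)) := by gcongr
    _ = rate N * entryCost f E := by
        rw [rate]
        push_cast
        ring

end Charging

/-! ### Cuts -/

/-- A cut is an index `b` such that every object of size class below `b` has its entry in a buffer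
below `b`; then the regions from `b` on can be rebuilt independently of those below `b`. -/
def IsCut (E : Multiset Entry) (b : ℕ) : Prop :=
  ∀ p ∈ E, sizeClass p.length < b → p.buffer < b

open Classical in
/-- The largest cut up to `c`. -/
noncomputable def cut (E : Multiset Entry) (c : ℕ) : ℕ := Nat.findGreatest (IsCut E) c

theorem isCut_cut (E : Multiset Entry) (c : ℕ) : IsCut E (cut E c) := by
  classical
  exact Nat.findGreatest_spec (P := IsCut E) (Nat.zero_le c)
    fun _ _ h => absurd h (Nat.not_lt_zero _)

theorem cut_le (E : Multiset Entry) (c : ℕ) : cut E c ≤ c := by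
  classical
  exact Nat.findGreatest_le c

theorem exists_skips_of_cut_le {E : Multiset Entry} {c j : ℕ} (h : cut E c ≤ j) (hj : j < c) :
    ∃ p ∈ E, p.Skips j := by
  classical
  have hnot : ¬ IsCut E (j + 1) :=
    Nat.findGreatest_is_greatest (Nat.lt_succ_of_le h) hj
  simp only [IsCut, not_forall, not_lt] at hnot
  obtain ⟨p, hp, hclass, hbuffer⟩ := hnot
  exact ⟨p, hp, Nat.le_of_lt_succ hclass, hbuffer⟩

/-! ### Requests as updates -/

/-- The objects `s'` arise from `s` by inserting the object `n` of length `w`. -/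
def IsInsertion (s s' : α →₀ ℕ) (n : α) (w : ℕ) : Prop := 0 < w ∧ s' n = w ∧ s'.erase n = s

/-- The objects `s'` arise from `s` by inserting or deleting the object `n` of length `w`. -/
def IsUpdate (s s' : α →₀ ℕ) (n : α) (w : ℕ) : Prop := IsInsertion s s' n w ∨ IsInsertion s' s n w

section IsUpdate

variable {s s' : α →₀ ℕ} {n m : α} {w : ℕ}

theorem IsInsertion.apply_self_eq_zero (h : IsInsertion s s' n w) : s n = 0 := by
  rw [← h.2.2, Finsupp.erase_same]

theorem IsInsertion.apply_of_ne (h : IsInsertion s s' n w) (hm : m ≠ n) : s' m = s m := by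
  rw [← h.2.2, Finsupp.erase_ne hm]

theorem IsInsertion.sum_eq {M : Type*} [AddCommMonoid M] (h : IsInsertion s s' n w) (g : ℕ → M) :
    (s'.sum fun _ l => g l) = g w + s.sum fun _ l => g l := by
  obtain ⟨hw, rfl, rfl⟩ := h
  exact (Finsupp.add_sum_erase s' n (fun _ l => g l) (Finsupp.mem_support_iff.2 hw.ne')).symm

theorem IsInsertion.classVol_eq (h : IsInsertion s s' n w) (j : ℕ) :
    classVol s' j = (if sizeClass w = j then w else 0) + classVol s j := by
  have hsum := h.sum_eq fun l => if sizeClass l = j then l else 0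
  simpa only [classVol, classOf, Finset.sum_filter, Finsupp.sum] using hsum

theorem IsUpdate.symm (h : IsUpdate s s' n w) : IsUpdate s' s n w := Or.symm h

theorem IsUpdate.length_pos (h : IsUpdate s s' n w) : 0 < w := h.elim And.left And.left

theorem IsUpdate.apply_of_ne (h : IsUpdate s s' n w) (hm : m ≠ n) : s' m = s m :=
  h.elim (·.apply_of_ne hm) fun h => (h.apply_of_ne hm).symm

theorem IsUpdate.apply_self (h : IsUpdate s s' n w) (hn : s' n ≠ 0) : s' n = w :=
  h.elim (·.2.1) fun h => absurd h.apply_self_eq_zero hn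

theorem IsUpdate.ne_of_ne_zero (h : IsUpdate s s' n w) (hm : s m ≠ 0) (hm' : s' m ≠ 0) :
    m ≠ n := by
  rintro rfl
  exact h.elim (fun h => hm h.apply_self_eq_zero) fun h => hm' h.apply_self_eq_zero

theorem IsUpdate.apply_of_sizeClass_lt (h : IsUpdate s s' n w) (hm : s' m ≠ 0)
    (hlt : sizeClass (s' m) < sizeClass w) : s' m = s m := by
  refine h.apply_of_ne ?_
  rintro rfl
  exact hlt.ne (by rw [h.apply_self hm])

theorem IsUpdate.classVol_le (h : IsUpdate s s' n w) (j : ℕ) :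
    classVol s' j ≤ (if sizeClass w = j then w else 0) + classVol s j :=
  h.elim (fun h => (h.classVol_eq j).le) fun h => by rw [h.classVol_eq j]; omega

theorem IsUpdate.classVol_of_lt (h : IsUpdate s s' n w) {j : ℕ} (hj : j < sizeClass w) :
    classVol s' j = classVol s j := by
  have hle := h.classVol_le j
  have hge := h.symm.classVol_le j
  rw [if_neg hj.ne', zero_add] at hle hge
  exact le_antisymm hle hge

end IsUpdate

/-! ### Regions of the array -/

/-- The first cell of region `j`: region `i` consists of a payload segment of `P i` cells and of a
buffer of `P i / N` cells. -/
def start (N : ℕ) (P : ℕ → ℕ) (j : ℕ) : ℕ := ∑ i ∈ Finset.range j, (P i + P i / N)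

theorem start_succ (N : ℕ) (P : ℕ → ℕ) (j : ℕ) :
    start N P (j + 1) = start N P j + (P j + P j / N) :=
  Finset.sum_range_succ _ j

theorem start_mono (N : ℕ) (P : ℕ → ℕ) : Monotone (start N P) :=
  monotone_nat_of_le_succ fun j => by
    rw [start_succ]
    exact Nat.le_add_right _ _

theorem start_congr {N : ℕ} {P Q : ℕ → ℕ} {j : ℕ} (h : ∀ i < j, P i = Q i) :
    start N P j = start N Q j :=
  Finset.sum_congr rfl fun i hi => by rw [h i (Finset.mem_range.1 hi)]

theorem start_le (N : ℕ) (P : ℕ → ℕ) (j : ℕ) :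
    (start N P j : ℝ) ≤ (1 + 1 / N) * ∑ i ∈ Finset.range j, (P i : ℝ) := by
  rw [start, Nat.cast_sum, Finset.mul_sum]
  refine Finset.sum_le_sum fun i _ => ?_
  have hdiv : ((P i / N : ℕ) : ℝ) ≤ P i / N := Nat.cast_div_le
  push_cast
  linarith [one_div_mul_eq_div (N : ℝ) (P i : ℝ)]

open Classical in
/-- Offsets that place the objects of `T` one after the other without gaps, in the order of an
arbitrary well-ordering. -/
noncomputable def packOffset (T : Finset α) (s : α → ℕ) (m : α) : ℕ :=
  ∑ k ∈ T with WellOrderingRel k m, s k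

theorem packOffset_add_le_sum {T : Finset α} {m : α} (hm : m ∈ T) (s : α → ℕ) :
    packOffset T s m + s m ≤ ∑ k ∈ T, s k := by
  classical
  have hnotMem : m ∉ T.filter (WellOrderingRel · m) :=
    fun h => irrefl_of WellOrderingRel m (Finset.mem_filter.1 h).2
  rw [packOffset, add_comm, ← Finset.sum_insert hnotMem]
  exact Finset.sum_le_sum_of_subset (Finset.insert_subset hm (Finset.filter_subset _ _))

theorem packOffset_add_le_packOffset {T : Finset α} {m k : α} (hm : m ∈ T)
    (hmk : WellOrderingRel m k) (s : α → ℕ) : packOffset T s m + s m ≤ packOffset T s k := by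
  classical
  have hm' : m ∈ T.filter (WellOrderingRel · k) := Finset.mem_filter.2 ⟨hm, hmk⟩
  refine le_trans (le_of_eq ?_) (packOffset_add_le_sum hm' s)
  rw [packOffset, packOffset, Finset.filter_filter]
  congr 2
  ext l
  simpa using fun _ hl => _root_.trans hl hmk

theorem packOffset_separated {T : Finset α} {m k : α} (hm : m ∈ T) (hk : k ∈ T) (hmk : m ≠ k)
    (s : α → ℕ) :
    packOffset T s m + s m ≤ packOffset T s k ∨ packOffset T s k + s k ≤ packOffset T s m := by
  rcases trichotomous_of WellOrderingRel m k with h | h | h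
  · exact .inl (packOffset_add_le_packOffset hm h s)
  · exact absurd h hmk
  · exact .inr (packOffset_add_le_packOffset hk h s)

/-! ### The state of the reallocator and its layout -/

/-- The state of the reallocator: the sizes of the payload segments, one entry for each request
since the last flush of its buffer, and the region in which every object lies, together with its
offset from the start of that region. -/
structure State (α : Type u) where
  payload : ℕ → ℕ
  entries : Multiset Entry
  region : α → ℕ
  offset : α → ℕ

namespace State

/-- The start addresses of the objects. -/
def place (N : ℕ) (σ : State α) (m : α) : ℕ := start N σ.payload (σ.region m) + σ.offset m

/-- The number of cells of region `j` in front of the unused part of its buffer. -/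
def used (σ : State α) (j : ℕ) : ℕ := σ.payload j + fill σ.entries j

/-- The layout of the regions is correct for the objects `s`. An object can be outside the region of
its size class only as long as its insertion is recorded in the buffer which it is in. -/
structure IsLayout (σ : State α) (s : α →₀ ℕ) : Prop where
  offset_add_le : ∀ m, s m ≠ 0 → σ.offset m + s m ≤ σ.used (σ.region m)
  separated : ∀ m k, s m ≠ 0 → s k ≠ 0 → m ≠ k → σ.region m = σ.region k →
    σ.offset m + s m ≤ σ.offset k ∨ σ.offset k + s k ≤ σ.offset m
  region_eq_or_mem : ∀ m, s m ≠ 0 →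
    σ.region m = sizeClass (s m) ∨ ⟨s m, σ.region m⟩ ∈ σ.entries

/-- The payload segments and the buffers are in accordance with the objects `s`. -/
structure IsBalanced (σ : State α) (N : ℕ) (s : α →₀ ℕ) : Prop where
  isAdmissible : ∀ p ∈ σ.entries, p.IsAdmissible
  lt_of_skips : ∀ p ∈ σ.entries, ∀ j, p.Skips j →
    σ.payload j < N * (fill σ.entries j + p.length)
  mul_fill_le : ∀ j, N * fill σ.entries j ≤ σ.payload j
  payload_eq_zero_or : ∀ j, σ.payload j = 0 ∨ 2 ^ j ≤ σ.payload j
  classVol_le : ∀ j, classVol s j ≤ σ.payload j + pending σ.entries j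
  payload_le : ∀ j, σ.payload j ≤ classVol s j + pending σ.entries j

section Geometry

variable {N : ℕ} {σ : State α} {s : α →₀ ℕ}

theorem start_add_used_le (hN : 0 < N) (hfill : ∀ j, N * fill σ.entries j ≤ σ.payload j) (j : ℕ) :
    start N σ.payload j + σ.used j ≤ start N σ.payload (j + 1) := by
  have hle : fill σ.entries j ≤ σ.payload j / N :=
    (Nat.le_div_iff_mul_le hN).2 (mul_comm N _ ▸ hfill j)
  rw [start_succ, used]
  omega

theorem IsLayout.place_add_le (h : σ.IsLayout s) (hN : 0 < N)
    (hfill : ∀ j, N * fill σ.entries j ≤ σ.payload j) {m : α} (hm : s m ≠ 0) {j : ℕ}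
    (hj : σ.region m < j) : σ.place N m + s m ≤ start N σ.payload j := by
  have hoffset := h.offset_add_le m hm
  have hused := start_add_used_le hN hfill (σ.region m)
  have hstart := start_mono N σ.payload (Nat.succ_le_of_lt hj)
  rw [Nat.succ_eq_add_one] at hstart
  rw [place]
  omega

theorem IsLayout.isAllocation (h : σ.IsLayout s) (hN : 0 < N)
    (hfill : ∀ j, N * fill σ.entries j ≤ σ.payload j) : IsAllocation s (σ.place N) := by
  intro m hm k hk hmk
  rw [Finset.mem_coe, Finsupp.mem_support_iff] at hm hk
  have hsep : σ.place N m + s m ≤ σ.place N k ∨ σ.place N k + s k ≤ σ.place N m := by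
    rcases lt_trichotomy (σ.region m) (σ.region k) with hlt | heq | hgt
    · exact .inl ((h.place_add_le hN hfill hm hlt).trans (Nat.le_add_right _ _))
    · have := h.separated m k hm hk hmk heq
      simp only [place, heq]
      omega
    · exact .inr ((h.place_add_le hN hfill hk hgt).trans (Nat.le_add_right _ _))
  rw [Function.onFun, Set.Ico_disjoint_Ico]
  omega

theorem IsLayout.region_lt (h : σ.IsLayout s) {b : ℕ} (hb : IsCut σ.entries b) {m : α}
    (hm : s m ≠ 0) (hmb : sizeClass (s m) < b) : σ.region m < b := by
  rcases h.region_eq_or_mem m hm with heq | hmem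
  · exact heq.trans_lt hmb
  · exact hb _ hmem hmb

end Geometry

/-! ### Recording a request in a buffer -/

open Classical in
/-- Record a request for the object `n` of length `w` in buffer `j`. The object is placed in the
cells of the entry; this is irrelevant for a deletion. -/
noncomputable def record (σ : State α) (n : α) (w j : ℕ) : State α where
  payload := σ.payload
  entries := ⟨w, j⟩ ::ₘ σ.entries
  region := Function.update σ.region n j
  offset := Function.update σ.offset n (σ.used j)

/-- A request for an object of length `w` may be recorded in buffer `j`, where there is room for
it. -/
def Fits (N : ℕ) (σ : State α) (w j : ℕ) : Prop :=
  sizeClass w ≤ j ∧ N * (fill σ.entries j + w) ≤ σ.payload j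

section Record

variable {N : ℕ} {σ : State α} {s s' : α →₀ ℕ} {n : α} {w j : ℕ}

theorem used_record (σ : State α) (n : α) (w j i : ℕ) :
    (σ.record n w j).used i = σ.used i + if j = i then w else 0 := by
  simp only [used, record, fill_cons]
  omega

theorem region_record_of_ne {m : α} (hm : m ≠ n) : (σ.record n w j).region m = σ.region m := by
  classical
  exact Function.update_of_ne hm _ _

theorem offset_record_of_ne {m : α} (hm : m ≠ n) : (σ.record n w j).offset m = σ.offset m := by
  classical
  exact Function.update_of_ne hm _ _

theorem region_record_self : (σ.record n w j).region n = j := by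
  classical
  exact Function.update_self n _ _

theorem offset_record_self : (σ.record n w j).offset n = σ.used j := by
  classical
  exact Function.update_self n _ _

theorem place_record_of_ne {m : α} (hm : m ≠ n) : (σ.record n w j).place N m = σ.place N m := by
  rw [place, region_record_of_ne hm, offset_record_of_ne hm]
  rfl

theorem IsLayout.record (h : σ.IsLayout s) (hu : IsUpdate s s' n w) (j : ℕ) :
    (σ.record n w j).IsLayout s' where
  offset_add_le m hm := by
    rw [used_record]
    rcases eq_or_ne m n with rfl | hmn
    · rw [offset_record_self, region_record_self, hu.apply_self hm, if_pos rfl]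
    · rw [offset_record_of_ne hmn, region_record_of_ne hmn]
      rw [hu.apply_of_ne hmn] at hm ⊢
      exact (h.offset_add_le m hm).trans (Nat.le_add_right _ _)
  separated m k hm hk hmk hregion := by
    rcases eq_or_ne m n with rfl | hmn
    · rw [region_record_self, region_record_of_ne hmk.symm] at hregion
      rw [offset_record_self, offset_record_of_ne hmk.symm, hregion]
      rw [hu.apply_of_ne hmk.symm] at hk ⊢
      exact .inr (h.offset_add_le k hk)
    rw [region_record_of_ne hmn] at hregion
    rw [offset_record_of_ne hmn]
    rw [hu.apply_of_ne hmn] at hm ⊢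
    rcases eq_or_ne k n with rfl | hkn
    · rw [region_record_self] at hregion
      rw [offset_record_self, ← hregion]
      exact .inl (h.offset_add_le m hm)
    · rw [region_record_of_ne hkn] at hregion
      rw [offset_record_of_ne hkn]
      rw [hu.apply_of_ne hkn] at hk ⊢
      exact h.separated m k hm hk hmk hregion
  region_eq_or_mem m hm := by
    rcases eq_or_ne m n with rfl | hmn
    · rw [region_record_self, hu.apply_self hm]
      exact .inr (Multiset.mem_cons_self _ _)
    · rw [region_record_of_ne hmn]
      rw [hu.apply_of_ne hmn] at hm ⊢
      exact (h.region_eq_or_mem m hm).imp_right Multiset.mem_cons_of_mem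

theorem IsBalanced.record (h : σ.IsBalanced N s) (hu : IsUpdate s s' n w) (hfits : σ.Fits N w j)
    (hfirst : ∀ i < j, ¬ σ.Fits N w i) : (σ.record n w j).IsBalanced N s' where
  isAdmissible p hp := by
    rcases Multiset.mem_cons.1 hp with rfl | hp
    · exact ⟨hu.length_pos, hfits.1⟩
    · exact h.isAdmissible p hp
  lt_of_skips p hp i hi := by
    have hlt : σ.payload i < N * (fill σ.entries i + p.length) := by
      rcases Multiset.mem_cons.1 hp with rfl | hp
      · exact not_le.1 fun hle => hfirst i hi.2 ⟨hi.1, hle⟩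
      · exact h.lt_of_skips p hp i hi
    refine hlt.trans_le (Nat.mul_le_mul_left N (Nat.add_le_add_right ?_ _))
    exact (Nat.le_add_left _ _).trans_eq (fill_cons _ _ _).symm
  mul_fill_le i := by
    simp only [State.record, fill_cons]
    split_ifs with hij
    · subst hij
      rw [add_comm]
      exact hfits.2
    · rw [zero_add]
      exact h.mul_fill_le i
  payload_eq_zero_or := h.payload_eq_zero_or
  classVol_le i := by
    have hvol := hu.classVol_le i
    have hold := h.classVol_le i
    simp only [State.record, pending_cons]
    omega
  payload_le i := by
    have hvol := hu.symm.classVol_le i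
    have hold := h.payload_le i
    simp only [State.record, pending_cons]
    omega

end Record

/-! ### Flushing a suffix of the regions -/

/-- Rebuild the regions from `b` on for the objects `s`. -/
noncomputable def flush (σ : State α) (s : α →₀ ℕ) (b : ℕ) : State α where
  payload j := if j < b then σ.payload j else classVol s j
  entries := σ.entries.filter (·.buffer < b)
  region m := if sizeClass (s m) < b then σ.region m else sizeClass (s m)
  offset m := if sizeClass (s m) < b then σ.offset m else
    packOffset (classOf s (sizeClass (s m))) s m

section Flush

variable {N : ℕ} {σ : State α} {s s' : α →₀ ℕ} {n m : α} {w b j : ℕ}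

theorem payload_flush_of_lt (hj : j < b) : (σ.flush s b).payload j = σ.payload j := if_pos hj

theorem payload_flush_of_le (hj : b ≤ j) : (σ.flush s b).payload j = classVol s j :=
  if_neg hj.not_gt

theorem fill_flush_of_lt (hj : j < b) : fill (σ.flush s b).entries j = fill σ.entries j :=
  fill_filter fun _ _ hp => hp.trans_lt hj

theorem fill_flush_of_le (hj : b ≤ j) : fill (σ.flush s b).entries j = 0 :=
  fill_eq_zero fun _ hp => ((Multiset.mem_filter.1 hp).2.trans_le hj).ne

theorem pending_flush_of_lt (hb : IsCut σ.entries b) (hj : j < b) :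
    pending (σ.flush s b).entries j = pending σ.entries j :=
  pending_filter fun p hp hpj => hb p hp (hpj.trans_lt hj)

theorem region_flush_of_lt (hm : sizeClass (s m) < b) : (σ.flush s b).region m = σ.region m :=
  if_pos hm

theorem region_flush_of_le (hm : b ≤ sizeClass (s m)) :
    (σ.flush s b).region m = sizeClass (s m) :=
  if_neg hm.not_gt

theorem offset_flush_of_lt (hm : sizeClass (s m) < b) : (σ.flush s b).offset m = σ.offset m :=
  if_pos hm

theorem offset_flush_of_le (hm : b ≤ sizeClass (s m)) :
    (σ.flush s b).offset m = packOffset (classOf s (sizeClass (s m))) s m :=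
  if_neg hm.not_gt

theorem place_flush_of_lt (hm : sizeClass (s m) < b) (hregion : σ.region m < b) :
    (σ.flush s b).place N m = σ.place N m := by
  rw [place, region_flush_of_lt hm, offset_flush_of_lt hm, place,
    start_congr fun i hi => payload_flush_of_lt (hi.trans hregion)]

theorem IsLayout.flush (h : σ.IsLayout s) (hu : IsUpdate s s' n w) (hb : IsCut σ.entries b)
    (hbw : b ≤ sizeClass w) : (σ.flush s' b).IsLayout s' := by
  have hlow : ∀ {m}, s' m ≠ 0 → sizeClass (s' m) < b → s' m = s m := fun hm hmb =>
    hu.apply_of_sizeClass_lt hm (hmb.trans_le hbw)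
  have hregion : ∀ {m}, s' m ≠ 0 → sizeClass (s' m) < b → σ.region m < b := fun hm hmb =>
    h.region_lt hb (hlow hm hmb ▸ hm) (hlow hm hmb ▸ hmb)
  constructor
  · intro m hm
    rw [used]
    rcases lt_or_ge (sizeClass (s' m)) b with hmb | hmb
    · have hrb := hregion hm hmb
      rw [region_flush_of_lt hmb, offset_flush_of_lt hmb, payload_flush_of_lt hrb,
        fill_flush_of_lt hrb, hlow hm hmb]
      exact h.offset_add_le m (hlow hm hmb ▸ hm)
    · rw [region_flush_of_le hmb, offset_flush_of_le hmb, payload_flush_of_le hmb,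
        fill_flush_of_le hmb]
      exact packOffset_add_le_sum (mem_classOf.2 ⟨hm, rfl⟩) s'
  · intro m k hm hk hmk heq
    rcases lt_or_ge (sizeClass (s' m)) b with hmb | hmb <;>
      rcases lt_or_ge (sizeClass (s' k)) b with hkb | hkb
    · rw [region_flush_of_lt hmb, region_flush_of_lt hkb] at heq
      rw [offset_flush_of_lt hmb, offset_flush_of_lt hkb, hlow hm hmb, hlow hk hkb]
      exact h.separated m k (hlow hm hmb ▸ hm) (hlow hk hkb ▸ hk) hmk heq
    · rw [region_flush_of_lt hmb, region_flush_of_le hkb] at heq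
      exact absurd (hregion hm hmb) (by omega)
    · rw [region_flush_of_le hmb, region_flush_of_lt hkb] at heq
      exact absurd (hregion hk hkb) (by omega)
    · rw [region_flush_of_le hmb, region_flush_of_le hkb] at heq
      rw [offset_flush_of_le hmb, offset_flush_of_le hkb, heq]
      exact packOffset_separated (mem_classOf.2 ⟨hm, heq⟩) (mem_classOf.2 ⟨hk, rfl⟩) hmk s'
  · intro m hm
    rcases lt_or_ge (sizeClass (s' m)) b with hmb | hmb
    · rw [region_flush_of_lt hmb, hlow hm hmb]
      exact (h.region_eq_or_mem m (hlow hm hmb ▸ hm)).imp_right fun hmem =>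
        Multiset.mem_filter.2 ⟨hmem, hregion hm hmb⟩
    · exact .inl (region_flush_of_le hmb)

theorem IsBalanced.flush (h : σ.IsBalanced N s) (hu : IsUpdate s s' n w) (hb : IsCut σ.entries b)
    (hbw : b ≤ sizeClass w) : (σ.flush s' b).IsBalanced N s' where
  isAdmissible p hp := h.isAdmissible p (Multiset.mem_filter.1 hp).1
  lt_of_skips p hp j hj := by
    obtain ⟨hp, hpb⟩ := Multiset.mem_filter.1 hp
    have hjb := hj.2.trans hpb
    rw [payload_flush_of_lt hjb, fill_flush_of_lt hjb]
    exact h.lt_of_skips p hp j hj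
  mul_fill_le j := by
    rcases lt_or_ge j b with hj | hj
    · rw [fill_flush_of_lt hj, payload_flush_of_lt hj]
      exact h.mul_fill_le j
    · rw [fill_flush_of_le hj, mul_zero]
      exact Nat.zero_le _
  payload_eq_zero_or j := by
    rcases lt_or_ge j b with hj | hj
    · rw [payload_flush_of_lt hj]
      exact h.payload_eq_zero_or j
    · rw [payload_flush_of_le hj]
      exact classVol_eq_zero_or_two_pow_le s' j
  classVol_le j := by
    rcases lt_or_ge j b with hj | hj
    · rw [payload_flush_of_lt hj, pending_flush_of_lt hb hj, hu.classVol_of_lt (hj.trans_le hbw)]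
      exact h.classVol_le j
    · exact (payload_flush_of_le hj).ge.trans (Nat.le_add_right _ _)
  payload_le j := by
    rcases lt_or_ge j b with hj | hj
    · rw [payload_flush_of_lt hj, pending_flush_of_lt hb hj, hu.classVol_of_lt (hj.trans_le hbw)]
      exact h.payload_le j
    · exact (payload_flush_of_le hj).le.trans (Nat.le_add_right _ _)

end Flush

/-! ### Serving a request -/

open Classical in
/-- Serve a request for the object `n` of length `w`, after which `s` are the active objects: record
it in the first buffer with room for it, or else flush the regions from the largest possible cut
on. -/
noncomputable def step (N : ℕ) (σ : State α) (s : α →₀ ℕ) (n : α) (w : ℕ) : State α :=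
  if h : ∃ j, σ.Fits N w j then σ.record n w (Nat.find h)
  else σ.flush s (cut σ.entries (sizeClass w))

section Step

variable {N : ℕ} {σ : State α} {s s' : α →₀ ℕ} {n : α} {w : ℕ}

theorem step_cases (N : ℕ) (σ : State α) (s : α →₀ ℕ) (n : α) (w : ℕ) :
    (∃ j, σ.Fits N w j ∧ (∀ i < j, ¬ σ.Fits N w i) ∧ σ.step N s n w = σ.record n w j) ∨
      (∀ j, ¬ σ.Fits N w j) ∧ σ.step N s n w = σ.flush s (cut σ.entries (sizeClass w)) := by
  classical
  by_cases h : ∃ j, σ.Fits N w j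
  · exact .inl ⟨Nat.find h, Nat.find_spec h, fun _ => Nat.find_min h, dif_pos h⟩
  · exact .inr ⟨not_exists.1 h, dif_neg h⟩

theorem IsLayout.step (h : σ.IsLayout s) (hu : IsUpdate s s' n w) :
    (σ.step N s' n w).IsLayout s' := by
  rcases step_cases N σ s' n w with ⟨j, -, -, hstep⟩ | ⟨-, hstep⟩ <;> rw [hstep]
  · exact h.record hu j
  · exact h.flush hu (isCut_cut _ _) (cut_le _ _)

theorem IsBalanced.step (h : σ.IsBalanced N s) (hu : IsUpdate s s' n w) :
    (σ.step N s' n w).IsBalanced N s' := by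
  rcases step_cases N σ s' n w with ⟨j, hfits, hfirst, hstep⟩ | ⟨-, hstep⟩ <;> rw [hstep]
  · exact h.record hu hfits hfirst
  · exact h.flush hu (isCut_cut _ _) (cut_le _ _)

theorem moveCost_record (f : ℕ → ℝ) (hu : IsUpdate s s' n w) (j : ℕ) :
    moveCost f s s' (σ.place N) ((σ.record n w j).place N) = 0 := by
  rw [moveCost, Finset.filter_eq_empty_iff.2, Finset.sum_empty]
  rintro m hm ⟨hm', hmove⟩
  exact hmove (place_record_of_ne (hu.ne_of_ne_zero (Finsupp.mem_support_iff.1 hm) hm')).symm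

/-- The requests that pay for flushing the regions from `b` on because of a request for an object
of length `w`. The latter is treated as if it had been recorded in buffer `M`, beyond all the
regions in use. -/
def payers (E : Multiset Entry) (w b M : ℕ) : Multiset Entry :=
  ⟨w, M⟩ ::ₘ E.filter (¬ ·.buffer < b)

theorem fill_payers (E : Multiset Entry) (w : ℕ) {b M j : ℕ} (hbj : b ≤ j) (hjM : j < M) :
    fill (payers E w b M) j = fill E j := by
  rw [payers, fill_cons, if_neg hjM.ne', zero_add]
  exact fill_filter fun p _ hp => by omega

theorem pending_payers {E : Multiset Entry} (hE : ∀ p ∈ E, p.IsAdmissible) (w M : ℕ) {b j : ℕ}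
    (hbj : b ≤ j) :
    pending (payers E w b M) j = (if sizeClass w = j then w else 0) + pending E j := by
  rw [payers, pending_cons]
  congr 1
  refine pending_filter fun p hp hpj => ?_
  have := (hE p hp).2
  omega

theorem IsBalanced.isAdmissible_of_mem_payers (h : σ.IsBalanced N s) {b M : ℕ} (hw : 0 < w)
    (hwM : sizeClass w ≤ M) {p : Entry} (hp : p ∈ payers σ.entries w b M) : p.IsAdmissible := by
  rcases Multiset.mem_cons.1 hp with rfl | hp
  · exact ⟨hw, hwM⟩
  · exact h.isAdmissible p (Multiset.mem_filter.1 hp).1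

theorem IsBalanced.exists_mem_payers (h : σ.IsBalanced N s) (hfull : ∀ j, ¬ σ.Fits N w j)
    {M j : ℕ} (hj : cut σ.entries (sizeClass w) ≤ j) (hjM : j < M) :
    ∃ p ∈ payers σ.entries w (cut σ.entries (sizeClass w)) M, sizeClass p.length ≤ j ∧
      σ.payload j <
        N * (fill (payers σ.entries w (cut σ.entries (sizeClass w)) M) j + p.length) := by
  rw [fill_payers _ _ hj hjM]
  rcases le_or_gt (sizeClass w) j with hwj | hwj
  · exact ⟨⟨w, M⟩, Multiset.mem_cons_self _ _, hwj, not_le.1 fun hle => hfull j ⟨hwj, hle⟩⟩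
  · obtain ⟨p, hp, hskips⟩ := exists_skips_of_cut_le hj hwj
    have hpay : ¬ p.buffer < cut σ.entries (sizeClass w) := (hj.trans hskips.2.le).not_gt
    exact ⟨p, Multiset.mem_cons_of_mem (Multiset.mem_filter.2 ⟨hp, hpay⟩), hskips.1,
      h.lt_of_skips p hp j hskips⟩

theorem sum_classCost_le_payers {f : ℕ → ℝ} (hf : IsSubadditiveCost f) (h : σ.IsBalanced N s)
    (hu : IsUpdate s s' n w) (hfull : ∀ j, ¬ σ.Fits N w j) {M : ℕ} (hwM : sizeClass w ≤ M) :
    ∑ j ∈ Finset.Ico (cut σ.entries (sizeClass w)) M, classCost f s' j ≤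
      rate N * entryCost f (payers σ.entries w (cut σ.entries (sizeClass w)) M) := by
  refine sum_classCost_le hf s' (fun _ => h.isAdmissible_of_mem_payers hu.length_pos hwM) _
    (fun j _ => h.payload_eq_zero_or j) (fun j hj => ?_) fun j hj =>
      h.exists_mem_payers hfull (Finset.mem_Ico.1 hj).1 (Finset.mem_Ico.1 hj).2
  have hnew := hu.classVol_le j
  have hold := h.classVol_le j
  rw [pending_payers h.isAdmissible w M (Finset.mem_Ico.1 hj).1]
  omega

theorem moveCost_le_sum_classCost {f : ℕ → ℝ} (hf : IsSubadditiveCost f)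
    (hu : IsUpdate s s' n w) {x x' : α → ℕ} {b M : ℕ}
    (hx : ∀ m, s m ≠ 0 → sizeClass (s m) < b → s' m = s m → x m = x' m)
    (hM : ∀ m, s' m ≠ 0 → sizeClass (s' m) < M) :
    moveCost f s s' x x' ≤ ∑ j ∈ Finset.Ico b M, classCost f s' j := by
  rw [sum_Ico_classCost f b hM, moveCost]
  have hsame : ∀ m ∈ s.support.filter (fun m => s' m ≠ 0 ∧ x m ≠ x' m), s' m = s m := by
    intro m hm
    obtain ⟨hm, hm', -⟩ := Finset.mem_filter.1 hm
    exact hu.apply_of_ne (hu.ne_of_ne_zero (Finsupp.mem_support_iff.1 hm) hm')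
  rw [Finset.sum_congr rfl fun m hm => by rw [← hsame m hm]]
  refine Finset.sum_le_sum_of_subset_of_nonneg (fun m hm => ?_) fun m hm _ =>
    hf.nonneg (Nat.pos_of_ne_zero (Finsupp.mem_support_iff.1 (Finset.mem_filter.1 hm).1))
  have hsm := hsame m hm
  obtain ⟨hm, hm', hmove⟩ := Finset.mem_filter.1 hm
  refine Finset.mem_filter.2 ⟨Finsupp.mem_support_iff.2 hm', not_lt.1 fun hlt => hmove ?_⟩
  exact hx m (Finsupp.mem_support_iff.1 hm) (hsm ▸ hlt) hsm

theorem exists_forall_sizeClass_lt (s : α →₀ ℕ) :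
    ∃ M, ∀ m, s m ≠ 0 → sizeClass (s m) < M :=
  ⟨s.support.sup (fun m => sizeClass (s m)) + 1, fun _ hm => Nat.lt_succ_of_le
    (Finset.le_sup (f := fun m => sizeClass (s m)) (Finsupp.mem_support_iff.2 hm))⟩

theorem moveCost_flush_add_le {f : ℕ → ℝ} (hf : IsSubadditiveCost f) (hl : σ.IsLayout s)
    (hb : σ.IsBalanced N s) (hu : IsUpdate s s' n w) (hfull : ∀ j, ¬ σ.Fits N w j) :
    moveCost f s s' (σ.place N) ((σ.flush s' (cut σ.entries (sizeClass w))).place N) +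
        rate N * entryCost f (σ.flush s' (cut σ.entries (sizeClass w))).entries ≤
      rate N * (entryCost f σ.entries + f w) := by
  obtain ⟨M, hM⟩ := exists_forall_sizeClass_lt s'
  have hmove := moveCost_le_sum_classCost hf hu (x := σ.place N)
    (x' := (σ.flush s' (cut σ.entries (sizeClass w))).place N)
    (fun m hm hmb hsm => (place_flush_of_lt (hsm.symm ▸ hmb)
      (hl.region_lt (isCut_cut _ _) hm hmb)).symm)
    fun m hm => (hM m hm).trans_le (le_max_left M (sizeClass w))
  have hcharge := sum_classCost_le_payers hf hb hu hfull (le_max_right M (sizeClass w))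
  rw [payers, entryCost_cons] at hcharge
  calc _ ≤ rate N * (f w + entryCost f
            (σ.entries.filter fun p => ¬ p.buffer < cut σ.entries (sizeClass w))) +
          rate N * entryCost f (σ.entries.filter (·.buffer < cut σ.entries (sizeClass w))) :=
        add_le_add_left (hmove.trans hcharge) _
    _ = rate N * (entryCost f σ.entries + f w) := by
        rw [← entryCost_filter_add_entryCost_filter_not f σ.entries
          (·.buffer < cut σ.entries (sizeClass w))]
        ring

theorem moveCost_step_add_le {f : ℕ → ℝ} (hf : IsSubadditiveCost f) (hl : σ.IsLayout s)
    (hb : σ.IsBalanced N s) (hu : IsUpdate s s' n w) :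
    moveCost f s s' (σ.place N) ((σ.step N s' n w).place N) +
        rate N * entryCost f (σ.step N s' n w).entries ≤
      rate N * (entryCost f σ.entries + f w) := by
  rcases step_cases N σ s' n w with ⟨j, -, -, hstep⟩ | ⟨hfull, hstep⟩ <;> rw [hstep]
  · rw [moveCost_record f hu, zero_add, record, entryCost_cons, add_comm]
  · exact moveCost_flush_add_le hf hl hb hu hfull

end Step

/-! ### The footprint -/

section Footprint

variable {N : ℕ} {σ : State α} {s : α →₀ ℕ}

theorem IsBalanced.mul_sum_payload_le (h : σ.IsBalanced N s) (hN : 0 < N) {M : ℕ}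
    (hM : ∀ m, s m ≠ 0 → sizeClass (s m) < M) (hE : ∀ p ∈ σ.entries, p.buffer < M) :
    (1 - 1 / N) * ∑ j ∈ Finset.range M, (σ.payload j : ℝ) ≤ volume s := by
  have hfill : N * totalLength σ.entries ≤ ∑ j ∈ Finset.range M, σ.payload j := by
    rw [← sum_range_totalLength_filter hE, Finset.mul_sum]
    exact Finset.sum_le_sum fun j _ => h.mul_fill_le j
  have hvol : ∑ j ∈ Finset.range M, σ.payload j ≤ volume s + totalLength σ.entries := by
    have hclass : ∀ p ∈ σ.entries, sizeClass p.length < M := fun p hp =>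
      (h.isAdmissible p hp).2.trans_lt (hE p hp)
    rw [← sum_range_classVol hM, ← sum_range_totalLength_filter hclass, ← Finset.sum_add_distrib]
    exact Finset.sum_le_sum fun j _ => h.payload_le j
  have hN' : (0 : ℝ) < N := by exact_mod_cast hN
  rw [← Nat.cast_sum]
  set Q := ∑ j ∈ Finset.range M, σ.payload j
  have hdiv : (totalLength σ.entries : ℝ) ≤ Q / N := by
    rw [le_div_iff₀' hN']
    exact_mod_cast hfill
  have hvol' : (Q : ℝ) ≤ volume s + totalLength σ.entries := by exact_mod_cast hvol
  linarith [one_div_mul_eq_div (N : ℝ) (Q : ℝ)]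

theorem IsLayout.footprint_place_le (h : σ.IsLayout s) (hN : 0 < N)
    (hfill : ∀ j, N * fill σ.entries j ≤ σ.payload j) {M : ℕ}
    (hM : ∀ m, s m ≠ 0 → sizeClass (s m) < M) (hE : ∀ p ∈ σ.entries, p.buffer < M) :
    footprint s (σ.place N) ≤ start N σ.payload M :=
  Finset.sup_le fun m hm => by
    rw [Finsupp.mem_support_iff] at hm
    exact h.place_add_le hN hfill hm (h.region_lt (fun p hp _ => hE p hp) hm (hM m hm))

theorem footprint_place_le_mul_volume (hl : σ.IsLayout s) (hb : σ.IsBalanced N s) {ε : ℝ}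
    (hε : 0 < ε) (hε' : ε ≤ 2) (hN : 4 / ε ≤ N) :
    (footprint s (σ.place N) : ℝ) ≤ (1 + ε) * volume s := by
  obtain ⟨M₁, hM₁⟩ := exists_forall_sizeClass_lt s
  set M := max M₁ ((σ.entries.map Entry.buffer).sup + 1)
  have hM : ∀ m, s m ≠ 0 → sizeClass (s m) < M := fun m hm => lt_max_of_lt_left (hM₁ m hm)
  have hE : ∀ p ∈ σ.entries, p.buffer < M := fun p hp => lt_max_of_lt_right
    (Nat.lt_succ_of_le (Multiset.le_sup (Multiset.mem_map_of_mem Entry.buffer hp)))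
  have hN_pos : (0 : ℝ) < N := lt_of_lt_of_le (by positivity) hN
  have hN_pos' : 0 < N := Nat.cast_pos.1 hN_pos
  have hinv : 1 / (N : ℝ) ≤ ε / 4 := by
    rw [div_le_iff₀ hε] at hN
    rw [div_le_div_iff₀ hN_pos four_pos]
    linarith
  calc (footprint s (σ.place N) : ℝ) ≤ start N σ.payload M :=
        Nat.cast_le.2 (hl.footprint_place_le hN_pos' hb.mul_fill_le hM hE)
    _ ≤ (1 + 1 / N) * ∑ j ∈ Finset.range M, (σ.payload j : ℝ) := start_le N σ.payload M
    _ ≤ (1 + ε) * (1 - 1 / N) * ∑ j ∈ Finset.range M, (σ.payload j : ℝ) := by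
        gcongr
        nlinarith
    _ = (1 + ε) * ((1 - 1 / N) * ∑ j ∈ Finset.range M, (σ.payload j : ℝ)) := mul_assoc _ _ _
    _ ≤ (1 + ε) * volume s := by
        gcongr
        exact hb.mul_sum_payload_le hN_pos' hM hE

end Footprint

end State

/-! ### The reallocator -/

/-- The name of the object that is inserted or deleted. -/
def Request.name : Request α → α
  | .insert n _ => n
  | .delete n => n

/-- The length of the object that is inserted or deleted, where `s` are the active objects before
the request. -/
def Request.length : Request α → (α →₀ ℕ) → ℕ
  | .insert _ w, _ => w
  | .delete n, s => s n

/-- The sum of the costs of the objects of all requests, which counts an object twice once it has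
been deleted. -/
noncomputable def requestCost (f : ℕ → ℝ) : List (Request α) → ℝ
  | [] => 0
  | r :: h => requestCost f h + f (r.length (active h))

/-- The state of the reallocator after the requests of the given history. -/
noncomputable def run (N : ℕ) : List (Request α) → State α
  | [] => ⟨fun _ => 0, 0, fun _ => 0, fun _ => 0⟩
  | r :: h => (run N h).step N (active (r :: h)) r.name (r.length (active h))

section Run

variable {N : ℕ} {f : ℕ → ℝ} {h : List (Request α)} {r : Request α} {n : α} {w : ℕ}

theorem isExecution_tail (hr : IsExecution (r :: h)) : IsExecution h := by
  cases r <;> exact hr.1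

theorem isInsertion_active_insert (hr : IsExecution (.insert n w :: h)) :
    IsInsertion (active h) (active (.insert n w :: h)) n w := by
  classical
  refine ⟨hr.2.2, ?_, ?_⟩
  · rw [active, Finsupp.update_apply, if_pos rfl]
  · rw [active, Finsupp.erase_update_eq_erase, Finsupp.erase_of_notMem_support hr.2.1]

theorem isInsertion_active_delete (hr : IsExecution (.delete n :: h)) :
    IsInsertion (active (.delete n :: h)) (active h) n (active h n) :=
  ⟨Nat.pos_of_ne_zero (Finsupp.mem_support_iff.1 hr.2), rfl, rfl⟩

theorem isUpdate_active_cons (hr : IsExecution (r :: h)) :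
    IsUpdate (active h) (active (r :: h)) r.name (r.length (active h)) := by
  cases r with
  | insert n w => exact .inl (isInsertion_active_insert hr)
  | delete n => exact .inr (isInsertion_active_delete hr)

theorem isLayout_run (N : ℕ) (hh : IsExecution h) : (run N h).IsLayout (active h) := by
  induction h with
  | nil => constructor <;> simp [active]
  | cons r h ih => exact (ih (isExecution_tail hh)).step (isUpdate_active_cons hh)

theorem isBalanced_run (N : ℕ) (hh : IsExecution h) : (run N h).IsBalanced N (active h) := by
  induction h with
  | nil => constructor <;> simp [run, active, fill, totalLength, classVol, classOf]
  | cons r h ih => exact (ih (isExecution_tail hh)).step (isUpdate_active_cons hh)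

/-- The reallocator with buffers of `1 / N` of the size of the payload segments. -/
noncomputable def bufferedReallocator (α : Type u) {N : ℕ} (hN : 0 < N) : Reallocator α where
  place h := (run N h).place N
  isAllocation _ hh := (isLayout_run N hh).isAllocation hN (isBalanced_run N hh).mul_fill_le

theorem requestCost_add_sum_active (f : ℕ → ℝ) (hh : IsExecution h) :
    requestCost f h + ((active h).sum fun _ l => f l) = 2 * allocCost f h := by
  induction h with
  | nil => simp [requestCost, active, allocCost]
  | cons r h ih =>
    specialize ih (isExecution_tail hh)
    cases r with
    | insert n w =>
      have hsum := (isInsertion_active_insert hh).sum_eq f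
      simp only [requestCost, Request.length, allocCost]
      linarith
    | delete n =>
      have hsum := (isInsertion_active_delete hh).sum_eq f
      simp only [requestCost, Request.length, allocCost]
      linarith

theorem requestCost_le (hf : IsSubadditiveCost f) (hh : IsExecution h) :
    requestCost f h ≤ 2 * allocCost f h := by
  rw [← requestCost_add_sum_active f hh]
  exact le_add_of_nonneg_right (Finset.sum_nonneg fun m hm =>
    hf.nonneg (Nat.pos_of_ne_zero (Finsupp.mem_support_iff.1 hm)))

theorem allocCost_nonneg (hf : IsSubadditiveCost f) (hh : IsExecution h) :
    0 ≤ allocCost f h := by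
  induction h with
  | nil => exact le_rfl
  | cons r h ih =>
    specialize ih (isExecution_tail hh)
    cases r with
    | insert n w => exact add_nonneg ih (hf.nonneg hh.2.2)
    | delete n => exact ih

theorem reallocCost_add_le (hf : IsSubadditiveCost f) (hN : 0 < N) (hh : IsExecution h) :
    reallocCost f (bufferedReallocator α hN) h + rate N * entryCost f (run N h).entries ≤
      rate N * requestCost f h := by
  induction h with
  | nil => simp [reallocCost, requestCost, run, entryCost]
  | cons r h ih =>
    have hh' := isExecution_tail hh
    have hstep := (run N h).moveCost_step_add_le hf (isLayout_run N hh') (isBalanced_run N hh')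
      (isUpdate_active_cons hh)
    simp only [reallocCost, requestCost, bufferedReallocator, run] at ih hstep ⊢
    linarith [ih hh']

theorem reallocCost_le (hf : IsSubadditiveCost f) (hN : 0 < N) (hh : IsExecution h) :
    reallocCost f (bufferedReallocator α hN) h ≤ 2 * rate N * allocCost f h := by
  have hentries : 0 ≤ entryCost f (run N h).entries := entryCost_nonneg fun p hp =>
    hf.nonneg ((isBalanced_run N hh).isAdmissible p hp).1
  have hrate := rate_nonneg N
  calc reallocCost f (bufferedReallocator α hN) h
      ≤ reallocCost f (bufferedReallocator α hN) h + rate N * entryCost f (run N h).entries :=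
        le_add_of_nonneg_right (by positivity)
    _ ≤ rate N * requestCost f h := reallocCost_add_le hf hN hh
    _ ≤ rate N * (2 * allocCost f h) := by
        gcongr
        exact requestCost_le hf hh
    _ = 2 * rate N * allocCost f h := by ring

end Run

theorem volume_le_footprint {s : α →₀ ℕ} {y : α → ℕ} (hy : IsAllocation s y) :
    volume s ≤ footprint s y := by
  classical
  have hdisj : (s.support : Set α).PairwiseDisjoint fun m => Finset.Ico (y m) (y m + s m) :=
    fun m hm k hk hmk => by simpa [Function.onFun, ← Finset.disjoint_coe] using hy hm hk hmk
  calc volume s = (s.support.disjiUnion _ hdisj).card := by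
        rw [Finset.card_disjiUnion, volume]
        simp only [Nat.card_Ico, Nat.add_sub_cancel_left]
    _ ≤ (Finset.range (footprint s y)).card := Finset.card_le_card fun i hi => by
        obtain ⟨m, hm, hi⟩ := Finset.mem_disjiUnion.1 hi
        exact Finset.mem_range.2 ((Finset.mem_Ico.1 hi).2.trans_le
          (Finset.le_sup (f := fun m => y m + s m) hm))
    _ = footprint s y := Finset.card_range _

theorem footprint_bufferedReallocator_le {N : ℕ} (hN : 0 < N) {ε : ℝ} (hε : 0 < ε) (hε' : ε ≤ 2)
    (hNε : 4 / ε ≤ N) {h : List (Request α)} (hh : IsExecution h) :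
    (footprint (active h) ((bufferedReallocator α hN).place h) : ℝ) ≤
      (1 + ε) * volume (active h) :=
  State.footprint_place_le_mul_volume (isLayout_run N hh) (isBalanced_run N hh) hε hε' hNε

theorem isCompetitive_bufferedReallocator {f : ℕ → ℝ} (hf : IsSubadditiveCost f) {N : ℕ}
    (hN : 0 < N) {ε : ℝ} (hε : 0 < ε) (hε' : ε ≤ 2) (hNε : 4 / ε ≤ N) {b : ℝ}
    (hb : 2 * rate N ≤ b) : (bufferedReallocator α hN).IsCompetitive f (1 + ε) b := by
  refine fun h hh => ⟨fun y hy => ?_, ?_⟩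
  · refine (footprint_bufferedReallocator_le hN hε hε' hNε hh).trans ?_
    gcongr
    exact volume_le_footprint hy
  · exact (reallocCost_le hf hN hh).trans
      (mul_le_mul_of_nonneg_right hb (allocCost_nonneg hf hh))

/-! ### The choice of `N` -/

theorem le_logb_two_one_div {ε : ℝ} (hε : 0 < ε) (hε' : ε ≤ 1 / 2) :
    1 ≤ Real.logb 2 (1 / ε) := by
  rw [Real.le_logb_iff_rpow_le one_lt_two (by positivity), Real.rpow_one, le_div_iff₀ hε]
  linarith

theorem spread_le {N : ℕ} (hN : 0 < N) {ε : ℝ} (hε : 0 < ε) (hNε : N ≤ 5 / ε) :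
    spread N ≤ 6 + Real.logb 2 (1 / ε) := by
  have hlog : (sizeClass N : ℝ) ≤ 3 + Real.logb 2 (1 / ε) :=
    calc (sizeClass N : ℝ) ≤ Real.logb 2 N := Real.natLog_le_logb N 2
      _ ≤ Real.logb 2 (2 ^ 3 * (1 / ε)) := by
          refine Real.logb_le_logb_of_le one_lt_two (by exact_mod_cast hN) (hNε.trans ?_)
          rw [div_eq_mul_one_div]
          gcongr
          norm_num
      _ = 3 + Real.logb 2 (1 / ε) := by
          rw [Real.logb_mul (by positivity) (by positivity), Real.logb_pow,
            Real.logb_self_eq_one one_lt_two]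
          norm_num
  rw [spread]
  push_cast
  linarith

theorem two_mul_rate_le {N : ℕ} (hN : 0 < N) {ε : ℝ} (hε : 0 < ε) (hε' : ε ≤ 1 / 2)
    (hNε : N ≤ 5 / ε) : 2 * rate N ≤ 340 * (1 / ε * Real.logb 2 (1 / ε)) := by
  have hspread := spread_le hN hε hNε
  have hlog := le_logb_two_one_div hε hε'
  have hinv : 2 ≤ 1 / ε := by
    rw [le_div_iff₀ hε]
    linarith
  rw [div_eq_mul_one_div] at hNε
  set L := Real.logb 2 (1 / ε)
  set x := 1 / ε
  have hx : x ≤ x * L := le_mul_of_one_le_right (by positivity) hlog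
  calc 2 * rate N = 4 + 8 * N * (1 + spread N) := by rw [rate]; ring
    _ ≤ 4 + 8 * (5 * x) * (1 + (6 + L)) := by gcongr
    _ = 4 + 280 * x + 40 * (x * L) := by ring
    _ ≤ 340 * (x * L) := by linarith

theorem natCeil_four_div_le {ε : ℝ} (hε : 0 < ε) (hε' : ε ≤ 1) : ⌈4 / ε⌉₊ ≤ 5 / ε := by
  have hceil := (Nat.ceil_lt_add_one (show 0 ≤ 4 / ε by positivity)).le
  have hone : 1 ≤ 1 / ε := one_le_one_div hε hε'
  calc (⌈4 / ε⌉₊ : ℝ) ≤ 4 / ε + 1 := hceil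
    _ ≤ 4 / ε + 1 / ε := by gcongr
    _ = 5 / ε := by ring

end StorageRealloc

theorem mainTheorem1 :
    ∃ C : ℝ, 0 < C ∧
      ∀ (α : Type*) (ε : ℝ), 0 < ε → ε ≤ 1 / 2 →
        ∃ A : StorageRealloc.Reallocator α,
          (∀ f : ℕ → ℝ, StorageRealloc.IsSubadditiveCost f →
            A.IsCompetitive f (1 + ε) (C * (1 / ε * Real.log (1 / ε)))) ∧
          ∀ h : List (StorageRealloc.Request α), StorageRealloc.IsExecution h →
            (StorageRealloc.footprint (StorageRealloc.active h) (A.place h) : ℝ) ≤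
              (1 + ε) * StorageRealloc.volume (StorageRealloc.active h) := by
  refine ⟨340 / Real.log 2, by positivity, fun α ε hε hε' => ?_⟩
  have hN : 0 < ⌈4 / ε⌉₊ := Nat.ceil_pos.2 (by positivity)
  have hNε : 4 / ε ≤ ⌈4 / ε⌉₊ := Nat.le_ceil _
  have hε_le_two : ε ≤ 2 := by linarith
  have hrate : 2 * StorageRealloc.rate ⌈4 / ε⌉₊ ≤
      340 / Real.log 2 * (1 / ε * Real.log (1 / ε)) :=
    (StorageRealloc.two_mul_rate_le hN hε hε'
      (StorageRealloc.natCeil_four_div_le hε (by linarith))).trans_eq (by rw [Real.logb]; ring)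
  exact ⟨StorageRealloc.bufferedReallocator α hN,
    fun f hf => StorageRealloc.isCompetitive_bufferedReallocator hf hN hε hε_le_two hNε hrate,
    fun h hh => StorageRealloc.footprint_bufferedReallocator_le hN hε hε_le_two hNε hh⟩
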